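/- Let $q$ be a prime power. An $[[n,k;c]]_q$ entanglement-assisted quantum (QUENTA) code encodes $k$ logical qudits (of dimension $q$) into $n$ physical qudits using $c$ maximally entangled pairs shared by sender and receiver; it is an $[[n,k,d;c]]_q$ code if its minimum distance is $d$, i.e. $d$ is the largest integer such that every error acting on fewer than $d$ of the $n$ physical qudits (the receiver's halves of the pairs being error-free) is detected. The code has maximal entanglement if $c=n-k$. Its quantum Singleton defect is $\lfloor (n-k+c)/2\rfloor+1-d$; the code is called MDS if the defect is $0$ and almost MDS if the defect is at most $1$. (1) Let $a_1,a_2,b_1,b_2$ be positive integers with $b_1\le a_2$, $b_2\le\min\{q-2-a_2,\,a_1\}$ and $a_1+a_2=b_1+b_2<q-1$. Then there is a maximal entanglement, almost MDS QUENTA code with parameters $$[[\,q-1,\ b_1+b_2+1,\ d;\ q-2-(a_1+a_2)\,]]_q,\qquad d\ge q-1-(a_1+a_2),$$ and if moreover $a_1\le q-2-a_2$, this code is MDS. (2) In particular, for all positive integers $a_1,a_2$ with $a_1\le q-2-a_2$ there is a maximal entanglement MDS QUENTA code with parameters $$[[\,q-1,\ a_1+a_2+1,\ d;\ q-2-(a_1+a_2)\,]]_q,\qquad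 d\ge q-1-(a_1+a_2).$$ -/

import Mathlib

open scoped InnerProductSpace

noncomputable section

/-- The Hilbert space with an orthonormal basis `|x⟩` labelled by the finite set `X`.
For a finite alphabet `A` with `q` letters, `StateSpace A` is a qudit `ℂ^q`,
`StateSpace (Fin n → A)` is the space of `n` qudits `(ℂ^q)^{⊗ n}` in its computational basis, and
`StateSpace (X × Y)` is the tensor product of `StateSpace X` and `StateSpace Y`. -/
abbrev StateSpace (X : Type*) : Type _ := EuclideanSpace ℂ X

/-- The amplitude at `|y⟩|y'⟩` of `c` copies of the maximally entangled state
`q^{-1/2} ∑_{a ∈ A} |a⟩|a⟩` of two qudits, where `q = |A|`: a product over the copies. -/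
def ebitAmplitude {A : Type*} [Fintype A] [DecidableEq A] {c : ℕ} (y y' : Fin c → A) : ℂ :=
  ∏ i, if y i = y' i then ((Real.sqrt (Fintype.card A) : ℝ) : ℂ)⁻¹ else 0

/-- An entanglement-assisted quantum code over the alphabet `A` that encodes `k` logical qudits
into `n` physical qudits using `c` maximally entangled pairs shared by the sender and the receiver.
It is given by the sender's encoding operation, an isometry from the `k` logical qudits together
with the sender's `c` halves of the pairs into the `n` physical qudits. (An isometry is the same as
adjoining `n - k - c` ancilla qudits in the state `|0⟩` and applying a unitary.) -/
structure QuentaCode (A : Type*) [Fintype A] [DecidableEq A] (n k c : ℕ) where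
  encoder : StateSpace ((Fin k → A) × (Fin c → A)) →ₗᵢ[ℂ] StateSpace (Fin n → A)

/-- The operator on `n` qudits that acts as `N` on the qudits at the positions in `S` and as the
identity on all the others. -/
def localError {A : Type*} [DecidableEq A] {n : ℕ} (S : Finset (Fin n))
    (N : Matrix (S → A) (S → A) ℂ) : Matrix (Fin n → A) (Fin n → A) ℂ :=
  fun x x' => if ∀ i, i ∉ S → x i = x' i then N (fun i => x i) (fun i => x' i) else 0

/-- The action of `M ⊗ 1`: the matrix `M` acts on the first tensor factor. -/
def actLeft {X Y : Type*} [Fintype X] (M : Matrix X X ℂ) (v : StateSpace (X × Y)) :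
    StateSpace (X × Y) :=
  WithLp.toLp 2 fun p => ∑ x', M p.1 x' * v (x', p.2)

namespace QuentaCode

variable {A : Type*} [Fintype A] [DecidableEq A] {n k c : ℕ}

/-- The encoding of a logical state `φ`: the state `(encoder ⊗ 1) (φ ⊗ Φ)` of the `n` physical qudits
and the receiver's `c` halves, where `Φ` stands for the `c` maximally entangled pairs. -/
def encode (Q : QuentaCode A n k c) :
    StateSpace (Fin k → A) →ₗ[ℂ] StateSpace ((Fin n → A) × (Fin c → A)) where
  toFun φ := WithLp.toLp 2 fun p =>
    Q.encoder (WithLp.toLp 2 fun r => φ r.1 * ebitAmplitude r.2 p.2) p.1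
  map_add' φ ψ := by
    ext p
    simp only [PiLp.add_apply, add_mul]
    rw [← PiLp.add_apply, ← map_add]
    rfl
  map_smul' t φ := by
    ext p
    simp only [PiLp.smul_apply, smul_eq_mul, mul_assoc, RingHom.id_apply]
    rw [← smul_eq_mul, ← PiLp.smul_apply, ← map_smul]
    rfl

/-- The code space: all encoded states. -/
def codeSpace (Q : QuentaCode A n k c) :
    Submodule ℂ (StateSpace ((Fin n → A) × (Fin c → A))) :=
  LinearMap.range Q.encode

/-- The code detects every error that acts on at most `w` of the `n` physical qudits; the receiver's
halves of the pairs are free of errors. This is the Knill-Laflamme condition `P E P = λ_E P` for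
the projection `P` onto the code space. -/
def DetectsWeight (Q : QuentaCode A n k c) (w : ℕ) : Prop :=
  ∀ S : Finset (Fin n), S.card ≤ w → ∀ N : Matrix (S → A) (S → A) ℂ,
    ∃ t : ℂ, ∀ v ∈ Q.codeSpace, ∀ v' ∈ Q.codeSpace,
      ⟪v, actLeft (localError S N) v'⟫_ℂ = t * ⟪v, v'⟫_ℂ

/-- `d` is the minimum distance of the code: the largest `d` such that all errors of weight less than
`d` are detected. In particular the code corrects all errors of weight at most `⌊(d - 1) / 2⌋`. -/
def HasMinDist (Q : QuentaCode A n k c) (d : ℕ) : Prop :=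
  IsGreatest {d : ℕ | ∀ w < d, Q.DetectsWeight w} d

/-- The code has maximal entanglement: `c = n - k`. -/
def MaximalEntanglement (_Q : QuentaCode A n k c) : Prop :=
  (c : ℤ) = (n : ℤ) - k

end QuentaCode

/-- The quantum Singleton defect `⌊(n - k + c) / 2⌋ + 1 - d` of the parameters `[[n, k, d; c]]`.
(Division of integers by `2` rounds down.) -/
def quantumSingletonDefect (n k d c : ℕ) : ℤ :=
  ((n : ℤ) - k + c) / 2 + 1 - d

end

/-!
In both families `n = q - 1`, `k = a₁ + a₂ + 1` and `c = n - k`, and the minimum distance is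
exactly `n - k + 1 = c + 1`, so all the codes are MDS. One construction covers every case.

Let `F` be the field with `q` elements, and let `α₁, …, αₙ` be its nonzero elements. The encoder
permutes the computational basis, `|u⟩|y⟩ ↦ |G u + H y⟩`, where
`(G u)ᵢ = ∑_{j < k} uⱼ αᵢʲ` and `(H y)ᵢ = αᵢᵏ ∑_{j < c} yⱼ αᵢʲ`: together these are the
evaluations of all polynomials of degree less than `n = k + c`, so `(u, y) ↦ G u + H y` is bijective.
The logical basis state `u` is encoded as `q^{-c/2} ∑_y |G u + H y⟩|y⟩`, and for an operator `M` on
the `n` qudits the matrix element between the encodings of `u` and `u'` is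
`q^{-c} ∑_y M (G u + H y) (G u' + H y)` (`inner_encode_actLeft`).

Let `M` act on a set `S` of at most `c` positions. If `u ≠ u'`, the matrix element vanishes,
because `G (u - u')` comes from a nonzero polynomial of degree less than `k` and cannot vanish at
the at least `k` positions outside `S`. If `u = u'`, it does not depend on `u`: since `H` is onto `F^S`,
there is a `y₀` such that `H y₀` and `G u` agree on `S`, and replacing `y` by `y + y₀` removes `G u`
from the sum. Hence all errors of weight at most `c` are detected. Conversely, some nonzero `G u`
is supported on `c + 1` positions, and the all-ones matrix on these positions is an undetected error.

The properties of `(u, y) ↦ G u + H y` that matter are collected in `IsMDSEncoding`, which refers to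
the alphabet as a mere set; the field enters only in `exists_isMDSEncoding_of_field`.
-/

open scoped InnerProductSpace

noncomputable section

/-! ### Polynomial evaluation -/

section Evaluation

variable {F ι : Type*} [Field F]

/-- The value at `x` of the polynomial with coefficients `u 0, …, u (m - 1)`. -/
def polyEval {m : ℕ} (u : Fin m → F) (x : F) : F := ∑ j, u j * x ^ (j : ℕ)

@[simp]
theorem polyEval_zero {m : ℕ} (x : F) : polyEval (0 : Fin m → F) x = 0 := by simp [polyEval]

theorem polyEval_add {m : ℕ} (u u' : Fin m → F) (x : F) :
    polyEval (u + u') x = polyEval u x + polyEval u' x := by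
  simp [polyEval, add_mul, Finset.sum_add_distrib]

theorem polyEval_sub {m : ℕ} (u u' : Fin m → F) (x : F) :
    polyEval (u - u') x = polyEval u x - polyEval u' x := by
  simp [polyEval, sub_mul, Finset.sum_sub_distrib]

theorem polyEval_fin_add {k c : ℕ} (w : Fin (k + c) → F) (x : F) :
    polyEval w x = polyEval (fun j => w (Fin.castAdd c j)) x +
      x ^ k * polyEval (fun j => w (Fin.natAdd k j)) x := by
  simp only [polyEval, Fin.sum_univ_add, Fin.val_castAdd, Fin.val_natAdd, Finset.mul_sum]
  congr 1
  exact Finset.sum_congr rfl fun j _ => by ring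

theorem exists_polyEval_eq [DecidableEq ι] {α : ι → F} (hα : Function.Injective α) {m : ℕ}
    (s : Finset ι) (hs : s.card ≤ m) (r : ι → F) :
    ∃ u : Fin m → F, ∀ i ∈ s, polyEval u (α i) = r i := by
  have hdeg : Lagrange.interpolate s α r ∈ Polynomial.degreeLT F m :=
    Polynomial.mem_degreeLT.2 <|
      (Lagrange.degree_interpolate_lt r hα.injOn).trans_le (by exact_mod_cast hs)
  refine ⟨Polynomial.degreeLTEquiv F m ⟨_, hdeg⟩, fun i hi => ?_⟩
  rw [polyEval, ← Polynomial.eval_eq_sum_degreeLTEquiv hdeg]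
  exact Lagrange.eval_interpolate_at_node r hα.injOn hi

theorem eq_zero_of_polyEval_eq_zero {α : ι → F} (hα : Function.Injective α) {m : ℕ}
    (s : Finset ι) (hs : m ≤ s.card) (u : Fin m → F) (hu : ∀ i ∈ s, polyEval u (α i) = 0) :
    u = 0 := by
  obtain ⟨p, rfl⟩ := (Polynomial.degreeLTEquiv F m).surjective u
  have hp : (p : Polynomial F) = 0 := by
    refine Polynomial.eq_zero_of_degree_lt_of_eval_index_eq_zero s hα.injOn
      ((Polynomial.mem_degreeLT.1 p.2).trans_le (by exact_mod_cast hs)) fun i hi => ?_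
    rw [Polynomial.eval_eq_sum_degreeLTEquiv p.2]
    exact hu i hi
  rw [(Subtype.ext hp : p = 0), map_zero]

end Evaluation

/-! ### Encodings of words -/

/-- The combinatorial properties of a bijective encoding `(u, y) ↦ E (u, y)` of words that make the
corresponding permutation of basis states an MDS code with maximal entanglement. For a linear
encoding `E (u, y) = G u + H y` they say that the image of `G` has minimum distance `c + 1`
(`eq_of_eqOn` and `exists_eqOn`), and that the dual of the image of `H` has minimum distance greater
than `c` (`exists_shift`). -/
structure IsMDSEncoding {A : Type*} {n k c : ℕ}
    (E : (Fin k → A) × (Fin c → A) ≃ (Fin n → A)) : Prop where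
  eq_of_eqOn : ∀ S : Finset (Fin n), S.card ≤ c → ∀ u u' y,
    (∀ i, i ∉ S → E (u, y) i = E (u', y) i) → u = u'
  exists_shift : ∀ S : Finset (Fin n), S.card ≤ c → ∃ u₀, ∀ u, ∃ σ : Equiv.Perm (Fin c → A),
    ∀ y, ∀ i ∈ S, E (u, y) i = E (u₀, σ y) i
  exists_eqOn : ∃ S : Finset (Fin n), S.card = c + 1 ∧ ∃ u u', u ≠ u' ∧
    ∀ y i, i ∉ S → E (u, y) i = E (u', y) i

/-- Evaluation of polynomials of degree less than `n` at `n` nonzero points, the coefficients being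
split into the `k` lower and the `c` upper ones. -/
theorem exists_isMDSEncoding_of_field {F : Type*} [Field F] [Finite F] {n k c : ℕ} (hk : 0 < k)
    (hn : n = k + c) {α : Fin n → F} (hα : Function.Injective α) (hα0 : ∀ i, α i ≠ 0) :
    ∃ E : (Fin k → F) × (Fin c → F) ≃ (Fin n → F), IsMDSEncoding E := by
  let f : (Fin k → F) × (Fin c → F) → (Fin n → F) :=
    fun w i => polyEval w.1 (α i) + α i ^ k * polyEval w.2 (α i)
  have hsurj : Function.Surjective f := fun r => by
    obtain ⟨w, hw⟩ := exists_polyEval_eq (m := k + c) hα Finset.univ (by simp [hn]) r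
    refine ⟨(fun j => w (Fin.castAdd c j), fun j => w (Fin.natAdd k j)), funext fun i => ?_⟩
    rw [← hw i (Finset.mem_univ i), polyEval_fin_add]
  have hcard : Nat.card ((Fin k → F) × (Fin c → F)) = Nat.card (Fin n → F) := by
    simp [Nat.card_prod, Nat.card_fun, hn, pow_add]
  refine ⟨Equiv.ofBijective f ((Nat.bijective_iff_surjective_and_card f).2 ⟨hsurj, hcard⟩), ?_, ?_, ?_⟩
  · intro S hS u u' y h
    refine sub_eq_zero.1 (eq_zero_of_polyEval_eq_zero hα Sᶜ ?_ _ fun i hi => ?_)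
    · rw [Finset.card_compl, Fintype.card_fin]
      omega
    · rw [polyEval_sub, sub_eq_zero]
      exact add_right_cancel (h i (Finset.mem_compl.1 hi))
  · intro S hS
    refine ⟨0, fun u => ?_⟩
    obtain ⟨y₀, hy₀⟩ := exists_polyEval_eq hα S hS fun i => polyEval u (α i) / α i ^ k
    refine ⟨Equiv.addRight y₀, fun y i hi => ?_⟩
    have h0 : α i ^ k ≠ 0 := pow_ne_zero _ (hα0 i)
    simp only [Equiv.ofBijective_apply, Equiv.coe_addRight, f, polyEval_zero, polyEval_add,
      hy₀ i hi]
    field_simp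
    ring
  · obtain ⟨S, -, hS⟩ := Finset.exists_subset_card_eq
      (show c + 1 ≤ (Finset.univ : Finset (Fin n)).card by simp; omega)
    obtain ⟨i₀, hi₀⟩ : S.Nonempty := Finset.card_pos.1 (by omega)
    -- A polynomial of degree less than `k` that vanishes outside `S` but not at the point `i₀` of `S`.
    obtain ⟨u, hu⟩ := exists_polyEval_eq (m := k) hα (insert i₀ Sᶜ)
      ((Finset.card_insert_le _ _).trans (by rw [Finset.card_compl, Fintype.card_fin]; omega))
      (Pi.single i₀ 1)
    refine ⟨S, hS, u, 0, ?_, fun y i hi => ?_⟩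
    · rintro rfl
      simpa using hu i₀ (Finset.mem_insert_self _ _)
    · have hne : i ≠ i₀ := fun h => hi (h ▸ hi₀)
      have := hu i (Finset.mem_insert_of_mem (Finset.mem_compl.2 hi))
      rw [Pi.single_eq_of_ne hne] at this
      simp [f, this]

theorem IsMDSEncoding.exists_of_equiv {A B : Type*} (e : A ≃ B) {n k c : ℕ}
    {E : (Fin k → B) × (Fin c → B) ≃ (Fin n → B)} (hE : IsMDSEncoding E) :
    ∃ E' : (Fin k → A) × (Fin c → A) ≃ (Fin n → A), IsMDSEncoding E' := by
  refine ⟨(((Equiv.refl _).arrowCongr e).prodCongr ((Equiv.refl _).arrowCongr e)).trans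
    (E.trans ((Equiv.refl _).arrowCongr e.symm)), ?_, ?_, ?_⟩
  · intro S hS u u' y h
    exact e.injective.comp_left <| hE.eq_of_eqOn S hS _ _ (e ∘ y)
      fun i hi => e.symm.injective (h i hi)
  · intro S hS
    obtain ⟨u₀, hu₀⟩ := hE.exists_shift S hS
    refine ⟨e.symm ∘ u₀, fun u => ?_⟩
    obtain ⟨σ, hσ⟩ := hu₀ (e ∘ u)
    refine ⟨((Equiv.refl _).arrowCongr e).trans (σ.trans ((Equiv.refl _).arrowCongr e.symm)),
      fun y i hi => ?_⟩
    have := congrArg e.symm (hσ (e ∘ y) i hi)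
    simpa [Equiv.arrowCongr, Function.comp_def] using this
  · obtain ⟨S, hS, u, u', hne, h⟩ := hE.exists_eqOn
    refine ⟨S, hS, e.symm ∘ u, e.symm ∘ u', fun h => hne (e.symm.injective.comp_left h),
      fun y i hi => ?_⟩
    have := congrArg e.symm (h (e ∘ y) i hi)
    simpa [Equiv.arrowCongr, Function.comp_def] using this

theorem exists_isMDSEncoding {q : ℕ} (hq : IsPrimePow q) {k c : ℕ} (hk : 0 < k)
    (hn : q - 1 = k + c) :
    ∃ E : (Fin k → Fin q) × (Fin c → Fin q) ≃ (Fin (q - 1) → Fin q), IsMDSEncoding E := by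
  obtain ⟨p, m, hp, hm, rfl⟩ := hq
  have : Fact p.Prime := ⟨hp.nat_prime⟩
  have hF : Nat.card (GaloisField p m) = p ^ m := GaloisField.card p m hm.ne'
  have hU : Nat.card (GaloisField p m)ˣ = p ^ m - 1 := by rw [Nat.card_units, hF]
  let α := (Finite.equivFinOfCardEq hU).symm
  obtain ⟨E, hE⟩ := exists_isMDSEncoding_of_field hk hn
    (α := fun i => (α i : GaloisField p m)) (Units.val_injective.comp α.injective)
    (fun i => (α i).ne_zero)
  exact hE.exists_of_equiv (Finite.equivFinOfCardEq hF).symm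

/-! ### Codes that permute the computational basis -/

namespace QuentaCode

variable {A : Type*} [Fintype A] [DecidableEq A] {n k c : ℕ}

/-- The code whose encoder maps the basis state `|u⟩|y⟩` to the basis state `|E (u, y)⟩`. -/
def ofEquiv (E : (Fin k → A) × (Fin c → A) ≃ (Fin n → A)) : QuentaCode A n k c :=
  ⟨(LinearIsometryEquiv.piLpCongrLeft 2 ℂ ℂ E).toLinearIsometry⟩

theorem ebitAmplitude_eq (y y' : Fin c → A) :
    ebitAmplitude y y' =
      if y = y' then (((Real.sqrt (Fintype.card A) : ℝ) : ℂ)⁻¹) ^ c else 0 := by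
  split_ifs with h
  · simp [ebitAmplitude, h]
  · obtain ⟨i, hi⟩ := Function.ne_iff.1 h
    exact Finset.prod_eq_zero (Finset.mem_univ i) (if_neg hi)

theorem ofEquiv_encode_apply (E : (Fin k → A) × (Fin c → A) ≃ (Fin n → A))
    (φ : StateSpace (Fin k → A)) (w : (Fin k → A) × (Fin c → A)) (y' : Fin c → A) :
    (ofEquiv E).encode φ (E w, y') = φ w.1 * ebitAmplitude w.2 y' := by
  simp [encode, ofEquiv, LinearIsometryEquiv.piLpCongrLeft_apply, Equiv.piCongrLeft']

theorem sum_mul_ebitAmplitude (g : (Fin c → A) → ℂ) (y' : Fin c → A) :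
    ∑ y, g y * ebitAmplitude y y' = g y' * (((Real.sqrt (Fintype.card A) : ℝ) : ℂ)⁻¹) ^ c := by
  simp [ebitAmplitude_eq]

/-- The factor `(q ^ c)⁻¹` comes from the two amplitudes of the entangled pairs, which also force
the two words `y` on the receiver's side to coincide. -/
theorem inner_encode_actLeft (E : (Fin k → A) × (Fin c → A) ≃ (Fin n → A))
    (M : Matrix (Fin n → A) (Fin n → A) ℂ) (φ ψ : StateSpace (Fin k → A)) :
    ⟪(ofEquiv E).encode φ, actLeft M ((ofEquiv E).encode ψ)⟫_ℂ =
      ((Fintype.card A : ℂ) ^ c)⁻¹ *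
        ∑ u, ∑ u', star (φ u) * ψ u' * ∑ y, M (E (u, y)) (E (u', y)) := by
  set κ : ℂ := (((Real.sqrt (Fintype.card A) : ℝ) : ℂ)⁻¹) ^ c with hκ
  have hκκ : κ * star κ = ((Fintype.card A : ℂ) ^ c)⁻¹ := by
    have h : ((Real.sqrt (Fintype.card A) : ℝ) : ℂ) * ((Real.sqrt (Fintype.card A) : ℝ) : ℂ) =
        Fintype.card A := by
      rw [← Complex.ofReal_mul, Real.mul_self_sqrt (Nat.cast_nonneg _), Complex.ofReal_natCast]
    have hs : star κ = κ := by
      rw [hκ, star_pow, star_inv₀]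
      simp
    rw [hs, hκ, ← mul_pow, ← mul_inv, h, inv_pow]
  have hact : ∀ x y, actLeft M ((ofEquiv E).encode ψ) (x, y) =
      κ * ∑ u', M x (E (u', y)) * ψ u' := by
    intro x y
    simp only [actLeft]
    rw [← E.sum_comp, Fintype.sum_prod_type, Finset.mul_sum]
    refine Finset.sum_congr rfl fun u' _ => ?_
    simp only [ofEquiv_encode_apply, ← mul_assoc]
    rw [sum_mul_ebitAmplitude (fun y => M x (E (u', y)) * ψ u')]
    ring
  have hinner : ⟪(ofEquiv E).encode φ, actLeft M ((ofEquiv E).encode ψ)⟫_ℂ =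
      ∑ y', ∑ u, ∑ y, (κ * ∑ u', M (E (u, y)) (E (u', y')) * ψ u') *
        star (φ u * ebitAmplitude y y') := by
    rw [PiLp.inner_apply, Fintype.sum_prod_type_right]
    refine Finset.sum_congr rfl fun y' _ => ?_
    rw [← E.sum_comp, Fintype.sum_prod_type]
    refine Finset.sum_congr rfl fun u _ => Finset.sum_congr rfl fun y _ => ?_
    rw [hact, RCLike.inner_apply, ofEquiv_encode_apply]
    rfl
  have hebit : ∀ y y' : Fin c → A, star (ebitAmplitude y y') = if y = y' then star κ else 0 := by
    intro y y'
    rw [ebitAmplitude_eq]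
    split_ifs <;> simp [hκ]
  rw [hinner, Finset.sum_comm, ← hκκ, Finset.mul_sum]
  refine Finset.sum_congr rfl fun u _ => ?_
  simp only [star_mul', hebit, mul_ite, mul_zero, Finset.sum_ite_eq', Finset.mem_univ, if_true]
  simp only [Finset.mul_sum, Finset.sum_mul]
  rw [Finset.sum_comm]
  exact Finset.sum_congr rfl fun u' _ => Finset.sum_congr rfl fun y _ => by ring

theorem inner_encode [Nonempty A] (E : (Fin k → A) × (Fin c → A) ≃ (Fin n → A))
    (φ ψ : StateSpace (Fin k → A)) :
    ⟪(ofEquiv E).encode φ, (ofEquiv E).encode ψ⟫_ℂ = ∑ u, star (φ u) * ψ u := by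
  have hone : actLeft 1 ((ofEquiv E).encode ψ) = (ofEquiv E).encode ψ := by
    ext p
    simp [actLeft, Matrix.one_apply]
  have hq : (Fintype.card A : ℂ) ≠ 0 := Nat.cast_ne_zero.2 Fintype.card_ne_zero
  have h := inner_encode_actLeft E 1 φ ψ
  rw [hone] at h
  rw [h, Finset.mul_sum]
  refine Finset.sum_congr rfl fun u _ => ?_
  rw [Finset.sum_eq_single u (fun u' _ hu' => by simp [hu'.symm]) (by simp)]
  simp
  field_simp

theorem detectsWeight_ofEquiv [Nonempty A] {E : (Fin k → A) × (Fin c → A) ≃ (Fin n → A)}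
    (hE : IsMDSEncoding E) {w : ℕ} (hw : w ≤ c) : (ofEquiv E).DetectsWeight w := by
  intro S hS N
  obtain ⟨u₀, hu₀⟩ := hE.exists_shift S (hS.trans hw)
  refine ⟨((Fintype.card A : ℂ) ^ c)⁻¹ *
    ∑ y, N (fun i => E (u₀, y) i) (fun i => E (u₀, y) i), ?_⟩
  rintro _ ⟨φ, rfl⟩ _ ⟨ψ, rfl⟩
  rw [inner_encode_actLeft, inner_encode, mul_assoc, Finset.mul_sum _ _ (∑ y, _)]
  congr 1
  refine Finset.sum_congr rfl fun u _ => ?_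
  rw [Finset.sum_eq_single u ?_ (by simp), mul_comm]
  · congr 1
    obtain ⟨σ, hσ⟩ := hu₀ u
    rw [← Equiv.sum_comp σ fun y => N (fun i => E (u₀, y) i) fun i => E (u₀, y) i]
    refine Finset.sum_congr rfl fun y _ => ?_
    have h : (fun i : S => E (u, y) i) = fun i : S => E (u₀, σ y) i :=
      funext fun i => hσ y i i.2
    simp [localError, h]
  · intro u' _ hu'
    rw [Finset.sum_eq_zero, mul_zero]
    exact fun y _ => if_neg fun h => hu' (hE.eq_of_eqOn S (hS.trans hw) u u' y h).symm

theorem not_detectsWeight_ofEquiv [Nonempty A] {E : (Fin k → A) × (Fin c → A) ≃ (Fin n → A)}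
    (hE : IsMDSEncoding E) : ¬ (ofEquiv E).DetectsWeight (c + 1) := by
  intro hdet
  obtain ⟨S, hS, u, u', hne, h⟩ := hE.exists_eqOn
  -- The all-ones matrix on `S` connects the orthogonal encodings of `u` and `u'`.
  obtain ⟨t, ht⟩ := hdet S hS.le (Matrix.of fun _ _ => 1)
  have hq : (Fintype.card A : ℂ) ≠ 0 := Nat.cast_ne_zero.2 Fintype.card_ne_zero
  have key := ht _ ⟨EuclideanSpace.single u 1, rfl⟩ _ ⟨EuclideanSpace.single u' 1, rfl⟩
  rw [inner_encode_actLeft, inner_encode] at key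
  have hsum : ∑ y, localError S (Matrix.of fun _ _ => 1) (E (u, y)) (E (u', y)) =
      (Fintype.card A : ℂ) ^ c := by
    have hone : ∀ y, localError S (Matrix.of fun _ _ => 1) (E (u, y)) (E (u', y)) = (1 : ℂ) :=
      fun y => if_pos (h y)
    simp [hone]
  rw [Finset.sum_eq_single u (fun v _ hv => by simp [hv]) (by simp),
    Finset.sum_eq_single u' (fun v _ hv => by simp [hv]) (by simp), hsum,
    Finset.sum_eq_zero fun v _ => ?_] at key
  · simp [hq] at key
  · by_cases hv : v = u
    · simp [hv, hne]
    · simp [hv]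

theorem hasMinDist_ofEquiv [Nonempty A] {E : (Fin k → A) × (Fin c → A) ≃ (Fin n → A)}
    (hE : IsMDSEncoding E) : (ofEquiv E).HasMinDist (c + 1) := by
  refine ⟨fun w hw => detectsWeight_ofEquiv hE (Nat.lt_succ_iff.1 hw), fun d hd => ?_⟩
  by_contra! hlt
  exact not_detectsWeight_ofEquiv hE (hd _ hlt)

end QuentaCode

theorem exists_quentaCode_hasMinDist {q : ℕ} (hq : IsPrimePow q) {k c : ℕ} (hk : 0 < k)
    (hn : q - 1 = k + c) :
    ∃ Q : QuentaCode (Fin q) (q - 1) k c, Q.HasMinDist (c + 1) := by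
  have : Nonempty (Fin q) := ⟨⟨0, hq.pos⟩⟩
  obtain ⟨E, hE⟩ := exists_isMDSEncoding hq hk hn
  exact ⟨QuentaCode.ofEquiv E, QuentaCode.hasMinDist_ofEquiv hE⟩

end

theorem mainTheorem3 (q : ℕ) (hq : IsPrimePow q) :
    (∀ a₁ a₂ b₁ b₂ : ℕ, 0 < a₁ → 0 < a₂ → 0 < b₁ → 0 < b₂ →
      b₁ ≤ a₂ → b₂ ≤ min (q - 2 - a₂) a₁ → a₁ + a₂ = b₁ + b₂ → b₁ + b₂ < q - 1 →
      ∃ (Q : QuentaCode (Fin q) (q - 1) (b₁ + b₂ + 1) (q - 2 - (a₁ + a₂))) (d : ℕ),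
        Q.HasMinDist d ∧ q - 1 - (a₁ + a₂) ≤ d ∧ Q.MaximalEntanglement ∧
        quantumSingletonDefect (q - 1) (b₁ + b₂ + 1) d (q - 2 - (a₁ + a₂)) ≤ 1 ∧
        (a₁ ≤ q - 2 - a₂ →
          quantumSingletonDefect (q - 1) (b₁ + b₂ + 1) d (q - 2 - (a₁ + a₂)) = 0)) ∧
    (∀ a₁ a₂ : ℕ, 0 < a₁ → 0 < a₂ → a₁ ≤ q - 2 - a₂ →
      ∃ (Q : QuentaCode (Fin q) (q - 1) (a₁ + a₂ + 1) (q - 2 - (a₁ + a₂))) (d : ℕ),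
        Q.HasMinDist d ∧ q - 1 - (a₁ + a₂) ≤ d ∧ Q.MaximalEntanglement ∧
        quantumSingletonDefect (q - 1) (a₁ + a₂ + 1) d (q - 2 - (a₁ + a₂)) = 0) := by
  have main : ∀ k c : ℕ, 0 < k → q - 1 = k + c →
      ∃ Q : QuentaCode (Fin q) (q - 1) k c, Q.HasMinDist (c + 1) ∧ Q.MaximalEntanglement ∧
        quantumSingletonDefect (q - 1) k (c + 1) c = 0 := by
    intro k c hk hn
    obtain ⟨Q, hQ⟩ := exists_quentaCode_hasMinDist hq hk hn
    refine ⟨Q, hQ, ?_, ?_⟩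
    · rw [QuentaCode.MaximalEntanglement]
      omega
    · rw [quantumSingletonDefect]
      omega
  refine ⟨fun a₁ a₂ b₁ b₂ _ _ _ _ _ _ hab hlt => ?_, fun a₁ a₂ h₁ _ hle => ?_⟩
  · obtain ⟨Q, hd, hme, hdef⟩ := main (b₁ + b₂ + 1) (q - 2 - (a₁ + a₂)) (by omega) (by omega)
    exact ⟨Q, _, hd, by omega, hme, by omega, fun _ => hdef⟩
  · obtain ⟨Q, hd, hme, hdef⟩ := main (a₁ + a₂ + 1) (q - 2 - (a₁ + a₂)) (by omega) (by omega)
    exact ⟨Q, _, hd, by omega, hme, hdef⟩
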